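/- Let $n\ge 2$, $a<b$, and let $\rho_0:[a,b]\to\mathbb R$ be a smooth positive function with $\rho_0'(a)=\rho_0'(b)=0$. Let $M_0\subset\mathbb R^{n+1}$ be the hypersurface generated by rotating the graph of $\rho_0$ about the $x_1$-axis. For $0<T<\infty$, let $(M_t)_{t\in[0,T)}$ be an axially symmetric volume preserving mean curvature flow starting at $M_0$ with Neumann boundary conditions. That is: $M_t$ is generated by rotating the graph of a positive function $\rho(\cdot,t):[a,b]\to\mathbb R$, with $\rho(\cdot,0)=\rho_0$; $\rho$ is smooth on $[a,b]\times(0,T)$, and $\rho$, $\rho'$, $\rho''$ (derivatives in $x_1$) are continuous on $[a,b]\times[0,T)$; $\rho'(a,t)=\rho'(b,t)=0$; and $M_t=\mathbf x(\cdot,t)(M^n)$, $M^n=[a,b]\times S^{n-1}$, where the position vector satisfies $$\frac{d}{dt}\mathbf x(l,t)=-\bigl(H(l,t)-h(t)\bigr)\nu(l,t),\qquad l\in M^n,\ 0<t<T,\qquad h(t)=\frac{\int_{M_t}H\,dg_t}{\int_{M_t}dg_t},$$ with $\nu$ the outer unit normal, $H$ the mean curvature with respect to $\nu$ (the sum of the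 principal curvatures), and $dg_t$ the area element of $M_t$. Let $\mathbf i_1$ be the unit vector along the $x_1$-axis, $\tau_1$ the unit tangent vector of $M_t$ along the meridians with $\langle\tau_1,\mathbf i_1\rangle>0$, $y$ the distance to the $x_1$-axis, and $\overline\nabla$ the flat connection of $\mathbb R^{n+1}$. The principal curvatures of $M_t$ are $$k=\langle\overline\nabla_{\tau_1}\nu,\tau_1\rangle=\frac{-\rho''}{(1+\rho'^2)^{3/2}},\qquad p=\frac{\langle\tau_1,\mathbf i_1\rangle}{y}=\frac1{\rho\sqrt{1+\rho'^2}},$$ where $p$ has multiplicity $n-1$. Then there is a constant $c_1$ depending only on the initial hypersurface $M_0$ (in particular independent of $T$, of the flow and of time) such that $$\frac kp<c_1\qquad\text{on } M_t\text{ for all } t\in[0,T).$$ -/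

import Mathlib

open Set MeasureTheory
open scoped ContDiff

namespace AxialFlow

noncomputable section

/-- The ambient space `ℝ^{n+1}`; the coordinate with index `0` is the `x₁` of the text. -/
abbrev Space (n : ℕ) : Type := EuclideanSpace ℝ (Fin (n + 1))

/-- The factor `ℝⁿ` orthogonal to the axis of rotation. -/
abbrev Cross (n : ℕ) : Type := EuclideanSpace ℝ (Fin n)

/-- The unit vector `i₁` spanning the axis of rotation. -/
def axis (n : ℕ) : Space n := EuclideanSpace.single 0 1

/-- The point of `ℝ^{n+1} = ℝ × ℝⁿ` with axial coordinate `c` and cross-sectional part `z`. -/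
def point {n : ℕ} (c : ℝ) (z : Cross n) : Space n := WithLp.toLp 2 (Fin.cons c fun i => z i)

/-- The axial coordinate `⟨x, i₁⟩`. -/
def axial {n : ℕ} (x : Space n) : ℝ := inner ℝ x (axis n)

/-- The cross-sectional part `x̂ = x - ⟨x, i₁⟩ i₁`, read as a vector of `ℝⁿ`. -/
def radial {n : ℕ} (x : Space n) : Cross n := WithLp.toLp 2 fun i => x i.succ

/-- The height function `y = |x̂|`. -/
def height {n : ℕ} (x : Space n) : ℝ := ‖radial x‖

/-- The direction `ω = x̂ / |x̂|`. -/
def direction {n : ℕ} (x : Space n) : Cross n := (height x)⁻¹ • radial x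

/-- The hypersurface generated by rotating the graph of `ρ : [a, b] → ℝ` about the `x₁`-axis. -/
def surface (n : ℕ) (a b : ℝ) (ρ : ℝ → ℝ) : Set (Space n) :=
  {x | axial x ∈ Icc a b ∧ height x = ρ (axial x)}

/-! ### Geometry of the hypersurface of revolution

The hypersurface is parametrized by `(s, θ) ∈ [a, b] × S^{n-1}`. All formulas in `θ` make sense for
`θ ∈ ℝⁿ`, and a derivative at `θ ∈ S^{n-1}` in a direction tangent to the sphere does not depend on
the extension. -/

/-- The parametrization `(s, θ) ↦ (s, ρ(s) θ)`. -/
def position {n : ℕ} (ρ : ℝ → ℝ) (s : ℝ) (θ : Cross n) : Space n := point s (ρ s • θ)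

/-- The outer unit normal `ν = (ω - ρ' i₁) / √(1 + ρ'²)`. -/
def normal {n : ℕ} (a b : ℝ) (ρ : ℝ → ℝ) (s : ℝ) (θ : Cross n) : Space n :=
  (√(1 + derivWithin ρ (Icc a b) s ^ 2))⁻¹ • point (-derivWithin ρ (Icc a b) s) θ

/-- The meridian tangent vector `∂ₛ` of the parametrization. -/
def meridian {n : ℕ} (a b : ℝ) (ρ : ℝ → ℝ) (s : ℝ) (θ : Cross n) : Space n :=
  derivWithin (fun σ => position ρ σ θ) (Icc a b) s

/-- The unit tangent vector `τ₁`, with `⟨τ₁, i₁⟩ > 0`. -/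
def tau {n : ℕ} (a b : ℝ) (ρ : ℝ → ℝ) (s : ℝ) (θ : Cross n) : Space n :=
  ‖meridian a b ρ s θ‖⁻¹ • meridian a b ρ s θ

/-- The principal curvature `k = ⟨∇̄_{τ₁} ν, τ₁⟩` in the meridian direction. -/
def curvK {n : ℕ} (a b : ℝ) (ρ : ℝ → ℝ) (s : ℝ) (θ : Cross n) : ℝ :=
  inner ℝ (‖meridian a b ρ s θ‖⁻¹ • derivWithin (fun σ => normal a b ρ σ θ) (Icc a b) s)
    (tau a b ρ s θ)

/-- The rotational principal curvature `p = ⟨τ₁, i₁⟩ / y`. -/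
def curvP {n : ℕ} (a b : ℝ) (ρ : ℝ → ℝ) (s : ℝ) (θ : Cross n) : ℝ :=
  inner ℝ (tau a b ρ s θ) (axis n) / height (position ρ s θ)

/-- An orthonormal basis of the tangent space `θ^⊥` of the unit sphere at `θ`. -/
def sphereFrame {n : ℕ} (θ : Cross n) :
    OrthonormalBasis (Fin (Module.finrank ℝ (ℝ ∙ θ)ᗮ)) ℝ (ℝ ∙ θ)ᗮ :=
  stdOrthonormalBasis ℝ (ℝ ∙ θ)ᗮ

/-- The tangent vector `D_e x` of the hypersurface for the `i`-th vector `e` of `sphereFrame θ`. -/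
def parallel {n : ℕ} (ρ : ℝ → ℝ) (s : ℝ) (θ : Cross n)
    (i : Fin (Module.finrank ℝ (ℝ ∙ θ)ᗮ)) : Space n :=
  lineDeriv ℝ (fun ζ => position ρ s ζ) θ (sphereFrame θ i : Cross n)

/-- The mean curvature `H`: the sum of `⟨∇̄_τ ν, τ⟩` over the orthonormal tangent frame consisting
of `τ₁` and the normalized vectors `parallel`. -/
def meanCurvature {n : ℕ} (a b : ℝ) (ρ : ℝ → ℝ) (s : ℝ) (θ : Cross n) : ℝ :=
  curvK a b ρ s θ + ∑ i, inner ℝ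
    (‖parallel ρ s θ i‖⁻¹ •
      lineDeriv ℝ (fun ζ => normal a b ρ s ζ) θ (sphereFrame θ i : Cross n))
    (‖parallel ρ s θ i‖⁻¹ • parallel ρ s θ i)

/-- The density of the area `dg` with respect to `ds dθ`: the Jacobian of the parametrization, the
product of the lengths of its mutually orthogonal tangent vectors. -/
def areaDensity {n : ℕ} (a b : ℝ) (ρ : ℝ → ℝ) (s : ℝ) (θ : Cross n) : ℝ :=
  ‖meridian a b ρ s θ‖ * ∏ i, ‖parallel ρ s θ i‖

/-- Integral over the hypersurface of a function of `(s, θ)`. -/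
def surfaceIntegral (n : ℕ) (a b : ℝ) (ρ : ℝ → ℝ) (f : ℝ → Cross n → ℝ) : ℝ :=
  ∫ s in a..b, ∫ θ : Metric.sphere (0 : Cross n) 1,
    f s θ * areaDensity a b ρ s (θ : Cross n) ∂(volume : Measure (Cross n)).toSphere

/-- The average `h = ∫ H dg / ∫ dg` of the mean curvature. -/
def averageCurvature (n : ℕ) (a b : ℝ) (ρ : ℝ → ℝ) : ℝ :=
  surfaceIntegral n a b ρ (meanCurvature a b ρ) / surfaceIntegral n a b ρ fun _ _ => 1

/-- A smooth positive radius function on `[a, b]` with `ρ₀'(a) = ρ₀'(b) = 0`. -/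
structure IsInitialRadius (a b : ℝ) (ρ₀ : ℝ → ℝ) : Prop where
  smooth : ContDiffOn ℝ ∞ ρ₀ (Icc a b)
  pos : ∀ s ∈ Icc a b, 0 < ρ₀ s
  neumann_left : derivWithin ρ₀ (Icc a b) a = 0
  neumann_right : derivWithin ρ₀ (Icc a b) b = 0

/-- Axially symmetric volume preserving mean curvature flow on `[0, T)` starting at the hypersurface
generated by `ρ₀`. Here `M_t` is generated by `ρ t : [a, b] → ℝ` and `x l t` is the position vector,
with parameter manifold `[a, b] × S^{n-1}`. The radius function is smooth for `t > 0` and of class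
`C²` in `s`, continuously, up to `t = 0`. No regularity of `x` in `l` is imposed. -/
structure IsFlow (n : ℕ) (a b : ℝ) (ρ₀ : ℝ → ℝ) (T : ℝ) (ρ : ℝ → ℝ → ℝ)
    (x : Icc a b × Metric.sphere (0 : Cross n) 1 → ℝ → Space n) : Prop where
  smooth : ContDiffOn ℝ ∞ (fun z : ℝ × ℝ => ρ z.1 z.2) (Ioo 0 T ×ˢ Icc a b)
  continuous_to_zero : ∀ m : ℕ, m ≤ 2 →
    ContinuousOn (fun z : ℝ × ℝ => iteratedDerivWithin m (ρ z.1) (Icc a b) z.2)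
      (Ico 0 T ×ˢ Icc a b)
  pos : ∀ t ∈ Ico 0 T, ∀ s ∈ Icc a b, 0 < ρ t s
  neumann_left : ∀ t ∈ Ioo 0 T, derivWithin (ρ t) (Icc a b) a = 0
  neumann_right : ∀ t ∈ Ioo 0 T, derivWithin (ρ t) (Icc a b) b = 0
  initial : ∀ s ∈ Icc a b, ρ 0 s = ρ₀ s
  image : ∀ t ∈ Ico 0 T, range (fun l => x l t) = surface n a b (ρ t)
  /-- The evolution equation `dx/dt = -(H - h) ν`. -/
  evolution : ∀ l, ∀ t ∈ Ioo 0 T, HasDerivAt (x l)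
    (-(meanCurvature a b (ρ t) (axial (x l t)) (direction (x l t)) - averageCurvature n a b (ρ t)) •
      normal a b (ρ t) (axial (x l t)) (direction (x l t))) t

end

end AxialFlow

namespace AxialFlow

/-! ### The splitting `ℝ^{n+1} = ℝ × ℝⁿ` -/

/-! The proof is a maximum principle for $F=k/p=-\rho\rho''/(1+\rho'^2)$. Following the points of
the flow shows that the radius solves $\rho_t=-(F+m)/\rho+h\sqrt{1+\rho'^2}$ with $m=n-1$
(`IsFlow.timeDeriv_eq`, `IsFlow.isGraphFlow`). Where $F'=0$ this gives
(`IsGraphFlow.timeDeriv_slabRatio`)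
$$F_t=\frac{F''}{1+\rho'^2}+\frac{2(F+m)(1-F)\rho'^2}{(1+\rho'^2)\rho^2}+\frac{hF(1-F)}{\rho\sqrt{1+\rho'^2}}.$$
If $h\ge 0$, the last two terms are nonpositive as soon as $F>1$, so $F$ can never exceed the larger
of $1$ and its initial maximum.

Two points need the Neumann condition. The sign of $h$ comes from an integration by parts of $k$
against the area element, whose boundary terms $\arctan(\rho')\rho^m$ vanish
(`integral_meanCurvature_nonneg`). A spatial maximum at $a$ or $b$ is still critical, since
$\rho'=0$ there for all times forces $F'=0$ (`IsGraphFlow.spaceDeriv_slabRatio_eq_zero`); hence the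
second derivative test extends to the endpoints. -/

@[simp] lemma point_zero {n : ℕ} (c : ℝ) (z : Cross n) : point c z 0 = c := rfl

@[simp] lemma point_succ {n : ℕ} (c : ℝ) (z : Cross n) (i : Fin n) : point c z i.succ = z i := rfl

@[simp] lemma axial_eq {n : ℕ} (x : Space n) : axial x = x 0 := by
  simp [axial, axis, EuclideanSpace.inner_single_right]

@[simp] lemma radial_point {n : ℕ} (c : ℝ) (z : Cross n) : radial (point c z) = z := rfl

lemma inner_point {n : ℕ} (c d : ℝ) (z w : Cross n) :
    inner ℝ (point c z) (point d w) = c * d + inner ℝ z w := by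
  simp [PiLp.inner_apply, Fin.sum_univ_succ, mul_comm]

lemma norm_point {n : ℕ} (c : ℝ) (z : Cross n) : ‖point c z‖ = √(c ^ 2 + ‖z‖ ^ 2) := by
  rw [norm_eq_sqrt_real_inner, inner_point, real_inner_self_eq_norm_sq, ← sq]

lemma smul_point {n : ℕ} (r c : ℝ) (z : Cross n) : r • point c z = point (r * c) (r • z) := by
  ext i
  refine Fin.cases ?_ (fun j => ?_) i <;> simp

lemma hasDerivWithinAt_point {n : ℕ} {c : ℝ → ℝ} {z : ℝ → Cross n} {c' : ℝ} {z' : Cross n}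
    {S : Set ℝ} {s : ℝ} (hc : HasDerivWithinAt c c' S s) (hz : HasDerivWithinAt z z' S s) :
    HasDerivWithinAt (fun σ => point (c σ) (z σ)) (point c' z') S s := by
  rw [hasDerivWithinAt_iff_hasFDerivWithinAt, hasFDerivWithinAt_euclidean]
  rw [hasDerivWithinAt_iff_hasFDerivWithinAt, hasFDerivWithinAt_euclidean] at hz
  intro i
  refine Fin.cases ?_ (fun j => ?_) i
  · exact (hasDerivWithinAt_iff_hasFDerivWithinAt.1 hc).congr_fderiv (by ext; simp)
  · exact (hz j).congr_fderiv (by ext; simp)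

/-! ### Curvatures of a hypersurface of revolution -/

section Curvature

variable {n : ℕ} {a b : ℝ} {ρ : ℝ → ℝ} {s : ℝ} {θ : Cross n}

lemma sqrt_one_add_sq_pos (r : ℝ) : 0 < √(1 + r ^ 2) := Real.sqrt_pos.2 (by positivity)

lemma sq_sqrt_one_add_sq (r : ℝ) : √(1 + r ^ 2) ^ 2 = 1 + r ^ 2 := Real.sq_sqrt (by positivity)

lemma height_position (hθ : ‖θ‖ = 1) (hρ : 0 < ρ s) : height (position ρ s θ) = ρ s := by
  simp [height, position, norm_smul, hθ, abs_of_pos hρ]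

lemma direction_position (hθ : ‖θ‖ = 1) (hρ : 0 < ρ s) : direction (position ρ s θ) = θ := by
  rw [direction, height_position hθ hρ, position, radial_point, smul_smul, inv_mul_cancel₀ hρ.ne',
    one_smul]

lemma axial_position : axial (position ρ s θ) = s := by simp [position]

lemma position_mem_surface (hs : s ∈ Icc a b) (hθ : ‖θ‖ = 1) (hρ : 0 < ρ s) :
    position ρ s θ ∈ surface n a b ρ := by
  refine ⟨?_, ?_⟩ <;> rw [axial_position]
  exacts [hs, height_position hθ hρ]

lemma meridian_eq (hab : a < b) (hs : s ∈ Icc a b)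
    (h : DifferentiableWithinAt ℝ ρ (Icc a b) s) :
    meridian a b ρ s θ = point 1 (derivWithin ρ (Icc a b) s • θ) :=
  (hasDerivWithinAt_point (hasDerivWithinAt_id s _)
    (h.hasDerivWithinAt.smul_const θ)).derivWithin (uniqueDiffOn_Icc hab s hs)

lemma norm_meridian (hab : a < b) (hs : s ∈ Icc a b) (hθ : ‖θ‖ = 1)
    (h : DifferentiableWithinAt ℝ ρ (Icc a b) s) :
    ‖meridian a b ρ s θ‖ = √(1 + derivWithin ρ (Icc a b) s ^ 2) := by
  rw [meridian_eq hab hs h, norm_point, norm_smul, hθ]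
  simp

lemma curvP_eq (hab : a < b) (hs : s ∈ Icc a b) (hθ : ‖θ‖ = 1) (hρ : 0 < ρ s)
    (h : DifferentiableWithinAt ℝ ρ (Icc a b) s) :
    curvP a b ρ s θ = 1 / (ρ s * √(1 + derivWithin ρ (Icc a b) s ^ 2)) := by
  rw [curvP, height_position hθ hρ, tau, norm_meridian hab hs hθ h, meridian_eq hab hs h,
    smul_point, ← axial]
  simp [div_eq_mul_inv, mul_comm]

lemma curvK_eq (hab : a < b) (hs : s ∈ Icc a b) (hθ : ‖θ‖ = 1)
    (h : DifferentiableWithinAt ℝ ρ (Icc a b) s)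
    (h' : DifferentiableWithinAt ℝ (derivWithin ρ (Icc a b)) (Icc a b) s) :
    curvK a b ρ s θ = -derivWithin (derivWithin ρ (Icc a b)) (Icc a b) s /
      √(1 + derivWithin ρ (Icc a b) s ^ 2) ^ 3 := by
  set r₁ := derivWithin ρ (Icc a b) s with hr₁
  set r₂ := derivWithin (derivWithin ρ (Icc a b)) (Icc a b) s with hr₂
  have hv := sqrt_one_add_sq_pos r₁
  -- Differentiability of this factor suffices: its derivative multiplies a vector orthogonal to the
  -- meridian and drops out of the inner product.
  have hq : DifferentiableWithinAt ℝ
      (fun σ => (√(1 + derivWithin ρ (Icc a b) σ ^ 2))⁻¹) (Icc a b) s :=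
    (((h'.pow 2).const_add 1).sqrt (ne_of_gt (add_pos_of_pos_of_nonneg one_pos (sq_nonneg _)))).inv (sqrt_one_add_sq_pos _).ne'
  have hN : HasDerivWithinAt (fun σ => point (-derivWithin ρ (Icc a b) σ) θ)
      (point (-r₂) 0) (Icc a b) s :=
    hasDerivWithinAt_point h'.hasDerivWithinAt.neg (hasDerivWithinAt_const _ _ _)
  have hD := (hq.hasDerivWithinAt.smul hN).derivWithin (uniqueDiffOn_Icc hab s hs)
  have hν : derivWithin (fun σ => normal a b ρ σ θ) (Icc a b) s = _ := hD
  rw [curvK, hν, tau, norm_meridian hab hs hθ h, meridian_eq hab hs h, ← hr₁]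
  simp only [inner_smul_left, inner_smul_right, inner_add_left, inner_point, inner_zero_left,
    real_inner_self_eq_norm_sq, hθ, RCLike.conj_to_real]
  field_simp
  ring

lemma parallel_eq (i : Fin (Module.finrank ℝ (ℝ ∙ θ)ᗮ)) :
    parallel ρ s θ i = point 0 (ρ s • (sphereFrame θ i : Cross n)) := by
  have : HasDerivWithinAt (fun t : ℝ => position ρ s (θ + t • (sphereFrame θ i : Cross n)))
      (point 0 (ρ s • (1 : ℝ) • (sphereFrame θ i : Cross n))) univ 0 :=
    hasDerivWithinAt_point (hasDerivWithinAt_const _ _ _)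
      ((((hasDerivWithinAt_id _ _).smul_const _).const_add θ).const_smul (ρ s))
  rw [one_smul] at this
  exact (hasDerivWithinAt_univ.1 this).deriv

lemma lineDeriv_normal (e : Cross n) :
    lineDeriv ℝ (fun ζ => normal a b ρ s ζ) θ e =
      (√(1 + derivWithin ρ (Icc a b) s ^ 2))⁻¹ • point 0 e := by
  have : HasDerivWithinAt (fun t : ℝ => normal a b ρ s (θ + t • e))
      ((√(1 + derivWithin ρ (Icc a b) s ^ 2))⁻¹ • point 0 ((1 : ℝ) • e)) univ 0 :=
    HasDerivWithinAt.fun_const_smul _ (hasDerivWithinAt_point (hasDerivWithinAt_const _ _ _)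
      (((hasDerivWithinAt_id _ _).smul_const _).const_add θ))
  rw [one_smul] at this
  exact (hasDerivWithinAt_univ.1 this).deriv

lemma norm_sphereFrame (i : Fin (Module.finrank ℝ (ℝ ∙ θ)ᗮ)) :
    ‖(sphereFrame θ i : Cross n)‖ = 1 := (sphereFrame θ).orthonormal.1 i

lemma norm_parallel (hρ : 0 < ρ s) (i : Fin (Module.finrank ℝ (ℝ ∙ θ)ᗮ)) :
    ‖parallel ρ s θ i‖ = ρ s := by
  rw [parallel_eq, norm_point, norm_smul, norm_sphereFrame]
  simp [abs_of_pos hρ, hρ.le]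

lemma finrank_orthogonal_span (hθ : ‖θ‖ = 1) : Module.finrank ℝ (ℝ ∙ θ)ᗮ = n - 1 := by
  have h := Submodule.finrank_add_finrank_orthogonal (ℝ ∙ θ)
  rw [finrank_span_singleton (norm_ne_zero_iff.1 (by simp [hθ])), finrank_euclideanSpace_fin] at h
  omega

lemma meanCurvature_eq (hn : 1 ≤ n) (hθ : ‖θ‖ = 1) (hρ : 0 < ρ s) :
    meanCurvature a b ρ s θ = curvK a b ρ s θ +
      (n - 1) / (ρ s * √(1 + derivWithin ρ (Icc a b) s ^ 2)) := by
  have hv := sqrt_one_add_sq_pos (derivWithin ρ (Icc a b) s)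
  have key : ∀ i, inner ℝ
      (‖parallel ρ s θ i‖⁻¹ •
        lineDeriv ℝ (fun ζ => normal a b ρ s ζ) θ (sphereFrame θ i : Cross n))
      (‖parallel ρ s θ i‖⁻¹ • parallel ρ s θ i) =
      1 / (ρ s * √(1 + derivWithin ρ (Icc a b) s ^ 2)) := by
    intro i
    rw [norm_parallel hρ, lineDeriv_normal, parallel_eq]
    simp only [inner_smul_left, inner_smul_right, inner_point, real_inner_self_eq_norm_sq,
      norm_sphereFrame, RCLike.conj_to_real]
    field_simp
    ring
  rw [meanCurvature, Finset.sum_congr rfl fun i _ => key i, Finset.sum_const, Finset.card_univ,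
    Fintype.card_fin, finrank_orthogonal_span hθ, nsmul_eq_mul, Nat.cast_sub hn]
  simp [div_eq_mul_inv]

lemma areaDensity_eq (hab : a < b) (hs : s ∈ Icc a b) (hθ : ‖θ‖ = 1) (hρ : 0 < ρ s)
    (h : DifferentiableWithinAt ℝ ρ (Icc a b) s) :
    areaDensity a b ρ s θ = √(1 + derivWithin ρ (Icc a b) s ^ 2) * ρ s ^ (n - 1) := by
  rw [areaDensity, norm_meridian hab hs hθ h, Finset.prod_congr rfl fun i _ => norm_parallel hρ i,
    Finset.prod_const, Finset.card_univ, Fintype.card_fin, finrank_orthogonal_span hθ]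

end Curvature

/-! ### The quotient of the curvatures and the sign of the average curvature -/

section Quotient

variable {n : ℕ} {a b : ℝ} {ρ : ℝ → ℝ} {s : ℝ} {θ : Cross n}

/-- The quotient `k / p` in terms of the radius function. -/
noncomputable def curvatureRatio (a b : ℝ) (ρ : ℝ → ℝ) (s : ℝ) : ℝ :=
  -(ρ s * derivWithin (derivWithin ρ (Icc a b)) (Icc a b) s) / (1 + derivWithin ρ (Icc a b) s ^ 2)

lemma differentiableOn_derivWithin_Icc (hab : a < b) (hρ : ContDiffOn ℝ 2 ρ (Icc a b)) :
    DifferentiableOn ℝ (derivWithin ρ (Icc a b)) (Icc a b) :=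
  (hρ.derivWithin (m := 1) (uniqueDiffOn_Icc hab) (by norm_num)).differentiableOn (by simp)

lemma curvK_div_curvP (hab : a < b) (hs : s ∈ Icc a b) (hθ : ‖θ‖ = 1) (hpos : 0 < ρ s)
    (hρ : ContDiffOn ℝ 2 ρ (Icc a b)) :
    curvK a b ρ s θ / curvP a b ρ s θ = curvatureRatio a b ρ s := by
  have hd := hρ.differentiableOn (by simp) s hs
  have hv := sqrt_one_add_sq_pos (derivWithin ρ (Icc a b) s)
  have hw := sq_sqrt_one_add_sq (derivWithin ρ (Icc a b) s)
  rw [curvK_eq hab hs hθ hd (differentiableOn_derivWithin_Icc hab hρ s hs),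
    curvP_eq hab hs hθ hpos hd, curvatureRatio]
  generalize √(1 + derivWithin ρ (Icc a b) s ^ 2) = v at hv hw
  rw [← hw]
  field_simp

lemma meanCurvature_eq_ratio (hn : 1 ≤ n) (hab : a < b) (hs : s ∈ Icc a b) (hθ : ‖θ‖ = 1)
    (hpos : 0 < ρ s) (hρ : ContDiffOn ℝ 2 ρ (Icc a b)) :
    meanCurvature a b ρ s θ = (curvatureRatio a b ρ s + (n - 1)) /
      (ρ s * √(1 + derivWithin ρ (Icc a b) s ^ 2)) := by
  have hv := sqrt_one_add_sq_pos (derivWithin ρ (Icc a b) s)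
  rw [meanCurvature_eq hn hθ hpos, ← curvK_div_curvP hab hs hθ hpos hρ,
    curvP_eq hab hs hθ hpos (hρ.differentiableOn (by simp) s hs)]
  field_simp

/-- Rotational symmetry makes the inner integral constant in `θ`, so the area of the sphere factors
out. For the sign of `h` only its nonnegativity matters. -/
lemma surfaceIntegral_eq_of_forall_sphere {f : ℝ → Cross n → ℝ} {g : ℝ → ℝ} (hab : a ≤ b)
    (h : ∀ s ∈ Icc a b, ∀ θ : Cross n, ‖θ‖ = 1 → f s θ * areaDensity a b ρ s θ = g s) :
    surfaceIntegral n a b ρ f =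
      (volume : Measure (Cross n)).toSphere.real univ * ∫ s in a..b, g s := by
  rw [surfaceIntegral, ← intervalIntegral.integral_const_mul]
  refine intervalIntegral.integral_congr fun s hs => ?_
  rw [uIcc_of_le hab] at hs
  have : ∀ θ : Metric.sphere (0 : Cross n) 1,
      f s θ * areaDensity a b ρ s (θ : Cross n) = g s :=
    fun θ => h s hs θ (by simp)
  simp only [this, integral_const, smul_eq_mul]

/-- `∫ H dg` is nonnegative, up to the area of the unit sphere: integrate `k` by parts. -/
lemma integral_meanCurvature_nonneg (hab : a < b) (m : ℕ) (hρ : ContDiffOn ℝ 2 ρ (Icc a b))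
    (hpos : ∀ s ∈ Icc a b, 0 < ρ s) (ha : derivWithin ρ (Icc a b) a = 0)
    (hb : derivWithin ρ (Icc a b) b = 0) :
    0 ≤ ∫ s in a..b, (curvatureRatio a b ρ s + m) * (ρ s ^ m / ρ s) := by
  have hρc : ContinuousOn ρ (Icc a b) := hρ.continuousOn
  have hd := differentiableOn_derivWithin_Icc hab hρ
  have hdc := hd.continuousOn
  have hddc : ContinuousOn (derivWithin (derivWithin ρ (Icc a b)) (Icc a b)) (Icc a b) :=
    (hρ.derivWithin (m := 1) (uniqueDiffOn_Icc hab) (by norm_num)).continuousOn_derivWithin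
      (uniqueDiffOn_Icc hab) (by simp)
  have hne : ∀ s ∈ Icc a b, ρ s ≠ 0 := fun s hs => (hpos s hs).ne'
  have hw : ∀ s ∈ Icc a b, 1 + derivWithin ρ (Icc a b) s ^ 2 ≠ 0 := fun s _ => by positivity
  have hFc : ContinuousOn (curvatureRatio a b ρ) (Icc a b) :=
    (hρc.mul hddc).neg.div (continuousOn_const.add (hdc.pow 2)) hw
  have hHc : ContinuousOn (fun s => (curvatureRatio a b ρ s + m) * (ρ s ^ m / ρ s)) (Icc a b) :=
    (hFc.add continuousOn_const).mul ((hρc.pow m).div hρc hne)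
  -- This integrand is what remains of `∫ H dg` after the integration by parts; it is nonnegative
  -- because `r * arctan r ≥ 0`.
  have hGc : ContinuousOn (fun s => m * (ρ s ^ m / ρ s) *
      (1 + derivWithin ρ (Icc a b) s * Real.arctan (derivWithin ρ (Icc a b) s))) (Icc a b) :=
    (continuousOn_const.mul ((hρc.pow m).div hρc hne)).mul
      (continuousOn_const.add (hdc.mul (Real.continuous_arctan.comp_continuousOn hdc)))
  have hHi := hHc.intervalIntegrable_of_Icc (μ := volume) hab.le
  have hGi := hGc.intervalIntegrable_of_Icc (μ := volume) hab.le
  have hprim : ∫ s in a..b, ((curvatureRatio a b ρ s + m) * (ρ s ^ m / ρ s) -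
      m * (ρ s ^ m / ρ s) *
        (1 + derivWithin ρ (Icc a b) s * Real.arctan (derivWithin ρ (Icc a b) s))) =
      (fun s => -(Real.arctan (derivWithin ρ (Icc a b) s) * ρ s ^ m)) b -
      (fun s => -(Real.arctan (derivWithin ρ (Icc a b) s) * ρ s ^ m)) a := by
    refine intervalIntegral.integral_eq_sub_of_hasDerivAt_of_le hab.le
      ((Real.continuous_arctan.comp_continuousOn hdc).mul (hρc.pow m)).neg (fun s hs => ?_)
      (hHi.sub hGi)
    have hs' := Ioo_subset_Icc_self hs
    have hmem := Icc_mem_nhds hs.1 hs.2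
    have h1 := (hρ.differentiableOn (by simp) s hs').hasDerivWithinAt.hasDerivAt hmem
    have h2 := (hd s hs').hasDerivWithinAt.hasDerivAt hmem
    refine (h2.arctan.mul (h1.pow m)).neg.congr_deriv ?_
    have hp := hpos s hs'
    -- The derivative of `ρ ^ m` carries the exponent `m - 1`, which is truncated at `m = 0`.
    rcases m with _ | m
    · simp only [curvatureRatio]
      simp
      field_simp
    · simp only [curvatureRatio]
      push_cast
      rw [Pi.pow_apply]
      field_simp
      ring
  rw [intervalIntegral.integral_sub hHi hGi] at hprim
  simp only [ha, hb, Real.arctan_zero, zero_mul, neg_zero, sub_zero] at hprim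
  rw [sub_eq_zero.1 hprim]
  refine intervalIntegral.integral_nonneg hab.le fun s hs => ?_
  have hp := hpos s hs
  have harc : 0 ≤ derivWithin ρ (Icc a b) s * Real.arctan (derivWithin ρ (Icc a b) s) := by
    rcases le_total 0 (derivWithin ρ (Icc a b) s) with h | h
    · exact mul_nonneg h (Real.arctan_nonneg.2 h)
    · exact mul_nonneg_of_nonpos_of_nonpos h (Real.arctan_zero ▸ Real.arctan_mono h)
  positivity

/-- The average curvature is nonnegative under Neumann boundary conditions. -/
lemma averageCurvature_nonneg (hn : 1 ≤ n) (hab : a < b) (hρ : ContDiffOn ℝ 2 ρ (Icc a b))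
    (hpos : ∀ s ∈ Icc a b, 0 < ρ s) (ha : derivWithin ρ (Icc a b) a = 0)
    (hb : derivWithin ρ (Icc a b) b = 0) : 0 ≤ averageCurvature n a b ρ := by
  have hd := hρ.differentiableOn (by simp)
  have hnum := surfaceIntegral_eq_of_forall_sphere (n := n) (ρ := ρ) (f := meanCurvature a b ρ)
    (g := fun s => (curvatureRatio a b ρ s + (n - 1 : ℕ)) * (ρ s ^ (n - 1) / ρ s)) hab.le
    fun s hs θ hθ => by
      have hv := sqrt_one_add_sq_pos (derivWithin ρ (Icc a b) s)
      have hp := hpos s hs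
      rw [meanCurvature_eq_ratio hn hab hs hθ hp hρ,
        areaDensity_eq hab hs hθ hp (hd s hs), Nat.cast_sub hn, Nat.cast_one]
      field_simp
  have hden := surfaceIntegral_eq_of_forall_sphere (n := n) (ρ := ρ) (f := fun _ _ => 1)
    (g := fun s => √(1 + derivWithin ρ (Icc a b) s ^ 2) * ρ s ^ (n - 1)) hab.le
    fun s hs θ hθ => by rw [areaDensity_eq hab hs hθ (hpos s hs) (hd s hs), one_mul]
  rw [averageCurvature, hnum, hden]
  refine div_nonneg (mul_nonneg measureReal_nonneg
    (integral_meanCurvature_nonneg hab _ hρ hpos ha hb)) (mul_nonneg measureReal_nonneg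
    (intervalIntegral.integral_nonneg hab.le fun s hs => ?_))
  have := hpos s hs
  positivity

end Quotient

/-! ### Partial derivatives on a space-time slab -/

section Slab

/-- The domain `(0, T) × [a, b]` in which the flow is smooth. -/
def slab (T a b : ℝ) : Set (ℝ × ℝ) := Ioo 0 T ×ˢ Icc a b

/-- The derivative of `g` within `S` in the direction `e`. -/
noncomputable def dirDeriv (S : Set (ℝ × ℝ)) (e : ℝ × ℝ) (g : ℝ × ℝ → ℝ) (z : ℝ × ℝ) : ℝ :=
  fderivWithin ℝ g S z e

variable {T a b t s : ℝ} {g : ℝ × ℝ → ℝ}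

lemma uniqueDiffOn_slab (hab : a < b) : UniqueDiffOn ℝ (slab T a b) :=
  isOpen_Ioo.uniqueDiffOn.prod (uniqueDiffOn_Icc hab)

lemma slab_subset_closure_interior (hab : a < b) :
    slab T a b ⊆ closure (interior (slab T a b)) := by
  rw [slab, interior_prod_eq, closure_prod_eq, interior_Icc, closure_Ioo hab.ne]
  rw [isOpen_Ioo.interior_eq]
  exact prod_mono subset_closure Subset.rfl

lemma contDiffOn_dirDeriv (hab : a < b) (e : ℝ × ℝ) (hg : ContDiffOn ℝ ∞ g (slab T a b)) :
    ContDiffOn ℝ ∞ (dirDeriv (slab T a b) e g) (slab T a b) :=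
  (hg.fderivWithin (uniqueDiffOn_slab hab) (by simp)).clm_apply contDiffOn_const

/-- Both sides are values of the second derivative within the slab. Its symmetry persists on the
lateral boundary because every point of the slab lies in the closure of the interior. -/
lemma dirDeriv_comm (hab : a < b) (d e : ℝ × ℝ) (hg : ContDiffOn ℝ ∞ g (slab T a b))
    {z : ℝ × ℝ} (hz : z ∈ slab T a b) :
    dirDeriv (slab T a b) d (dirDeriv (slab T a b) e g) z =
      dirDeriv (slab T a b) e (dirDeriv (slab T a b) d g) z := by
  have hu := uniqueDiffOn_slab (T := T) hab
  have hd : DifferentiableWithinAt ℝ (fderivWithin ℝ g (slab T a b)) (slab T a b) z :=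
    (hg.fderivWithin (m := ∞) hu (by simp)).differentiableOn (by simp) z hz
  have key : ∀ c c' : ℝ × ℝ, dirDeriv (slab T a b) c (dirDeriv (slab T a b) c' g) z =
      fderivWithin ℝ (fderivWithin ℝ g (slab T a b)) (slab T a b) z c c' := by
    intro c c'
    have := (hd.hasFDerivWithinAt.clm_apply (hasFDerivWithinAt_const c' z _)).fderivWithin
      (hu z hz)
    have h2 := congrArg (fun L : ℝ × ℝ →L[ℝ] ℝ => L c) this
    exact h2.trans (by simp)
  rw [key, key]
  exact (hg z hz).isSymmSndFDerivWithinAt (by simpa using! ENat.LEInfty.out) hu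
    (slab_subset_closure_interior hab hz) hz d e

/-- The curve may touch `a` or `b`, where `g` is differentiable only within the slab. It stays in
the slab for an open interval of times, so the chain rule still yields a two-sided derivative. -/
lemma hasDerivAt_slab_curve (hg : ContDiffOn ℝ ∞ g (slab T a b)) {ξ : ℝ → ℝ} {ξ' : ℝ}
    (ht : t ∈ Ioo 0 T) (hξ : HasDerivAt ξ ξ' t) (hmem : ∀ τ ∈ Ioo 0 T, ξ τ ∈ Icc a b) :
    HasDerivAt (fun τ => g (τ, ξ τ)) (dirDeriv (slab T a b) (1, 0) g (t, ξ t) +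
      dirDeriv (slab T a b) (0, 1) g (t, ξ t) * ξ') t := by
  have hz : (t, ξ t) ∈ slab T a b := ⟨ht, hmem t ht⟩
  have h1 := (hg.differentiableOn (by simp) _ hz).hasFDerivWithinAt
  have h2 : HasDerivWithinAt (fun τ => (τ, ξ τ)) (1, ξ') (Ioo 0 T) t :=
    ((hasDerivAt_id t).prodMk hξ).hasDerivWithinAt
  have hmaps : MapsTo (fun τ => (τ, ξ τ)) (Ioo 0 T) (slab T a b) := fun τ hτ => ⟨hτ, hmem τ hτ⟩
  have h3 := (h1.comp_hasDerivWithinAt t h2 hmaps).hasDerivAt (isOpen_Ioo.mem_nhds ht)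
  refine h3.congr_deriv ?_
  have : ((1 : ℝ), ξ') = (1, 0) + ξ' • (0, 1) := by simp
  rw [this, map_add, map_smul, smul_eq_mul, mul_comm]
  rfl

lemma hasDerivAt_slab_time (hg : ContDiffOn ℝ ∞ g (slab T a b)) (ht : t ∈ Ioo 0 T)
    (hs : s ∈ Icc a b) :
    HasDerivAt (fun τ => g (τ, s)) (dirDeriv (slab T a b) (1, 0) g (t, s)) t := by
  simpa using hasDerivAt_slab_curve hg ht (hasDerivAt_const t s) fun _ _ => hs

lemma hasDerivWithinAt_slab_space (hg : ContDiffOn ℝ ∞ g (slab T a b)) (ht : t ∈ Ioo 0 T)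
    (hs : s ∈ Icc a b) : HasDerivWithinAt (fun σ => g (t, σ))
      (dirDeriv (slab T a b) (0, 1) g (t, s)) (Icc a b) s :=
  ((hg.differentiableOn (by simp) (t, s) ⟨ht, hs⟩).hasFDerivWithinAt.comp_hasDerivWithinAt s
    ((hasDerivWithinAt_const s _ t).prodMk (hasDerivWithinAt_id s _)) fun _ hσ => ⟨ht, hσ⟩ :)

end Slab

/-! ### The evolution of the quotient of the curvatures for the graph equation -/

section GraphFlow

/-- The partial derivative in time of a function on the slab. -/
noncomputable abbrev timeDeriv (T a b : ℝ) (g : ℝ × ℝ → ℝ) : ℝ × ℝ → ℝ :=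
  dirDeriv (slab T a b) (1, 0) g

/-- The partial derivative in space of a function on the slab. -/
noncomputable abbrev spaceDeriv (T a b : ℝ) (g : ℝ × ℝ → ℝ) : ℝ × ℝ → ℝ :=
  dirDeriv (slab T a b) (0, 1) g

/-- The quotient `k / p` as a function on the slab. -/
noncomputable def slabRatio (T a b : ℝ) (u : ℝ × ℝ → ℝ) (z : ℝ × ℝ) : ℝ :=
  -(u z * spaceDeriv T a b (spaceDeriv T a b u) z) / (1 + spaceDeriv T a b u z ^ 2)

/-- The equation `uₜ = -(k / p + m) / u + h √(1 + u'²)` with Neumann boundary conditions. -/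
structure IsGraphFlow (T a b m : ℝ) (h : ℝ → ℝ) (u : ℝ × ℝ → ℝ) : Prop where
  smooth : ContDiffOn ℝ ∞ u (slab T a b)
  pos : ∀ z ∈ slab T a b, 0 < u z
  neumann_left : ∀ t ∈ Ioo 0 T, spaceDeriv T a b u (t, a) = 0
  neumann_right : ∀ t ∈ Ioo 0 T, spaceDeriv T a b u (t, b) = 0
  nonneg : ∀ t ∈ Ioo 0 T, 0 ≤ h t
  equation : ∀ z ∈ slab T a b, timeDeriv T a b u z =
    -(slabRatio T a b u z + m) / u z + h z.1 * √(1 + spaceDeriv T a b u z ^ 2)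

variable {T a b m t s : ℝ} {h : ℝ → ℝ} {u : ℝ × ℝ → ℝ}

lemma contDiffOn_slabRatio (hab : a < b) (hu : ContDiffOn ℝ ∞ u (slab T a b)) :
    ContDiffOn ℝ ∞ (slabRatio T a b u) (slab T a b) :=
  (hu.mul (contDiffOn_dirDeriv hab _ (contDiffOn_dirDeriv hab _ hu))).neg.div
    (contDiffOn_const.add ((contDiffOn_dirDeriv hab _ hu).pow 2)) fun z _ => by positivity

/-- Used to eliminate `u''`, so that the evolution equations are written in `u`, `u'`, `k / p` and
derivatives of `k / p`. -/
lemma spaceDeriv_spaceDeriv_eq (hu : ∀ z ∈ slab T a b, 0 < u z) {z : ℝ × ℝ}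
    (hz : z ∈ slab T a b) : spaceDeriv T a b (spaceDeriv T a b u) z =
      -((1 + spaceDeriv T a b u z ^ 2) * slabRatio T a b u z) / u z := by
  have := hu z hz
  have hw : 1 + spaceDeriv T a b u z ^ 2 ≠ 0 := by positivity
  rw [slabRatio]
  field_simp

lemma hasDerivWithinAt_sqrt_slope (hab : a < b) (hu : ContDiffOn ℝ ∞ u (slab T a b))
    (ht : t ∈ Ioo 0 T) (hs : s ∈ Icc a b) :
    HasDerivWithinAt (fun σ => √(1 + spaceDeriv T a b u (t, σ) ^ 2))
      (spaceDeriv T a b u (t, s) * spaceDeriv T a b (spaceDeriv T a b u) (t, s) /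
        √(1 + spaceDeriv T a b u (t, s) ^ 2)) (Icc a b) s := by
  have h1 := hasDerivWithinAt_slab_space (contDiffOn_dirDeriv hab (0, 1) hu) ht hs
  refine (((h1.fun_pow 2).const_add 1).sqrt
    (ne_of_gt (add_pos_of_pos_of_nonneg one_pos (sq_nonneg _)))).congr_deriv ?_
  field_simp
  push_cast
  ring

/-- The derivative in space of the graph equation. -/
lemma IsGraphFlow.timeDeriv_spaceDeriv (hab : a < b) (H : IsGraphFlow T a b m h u)
    {z : ℝ × ℝ} (hz : z ∈ slab T a b) : timeDeriv T a b (spaceDeriv T a b u) z =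
      -spaceDeriv T a b (slabRatio T a b u) z / u z +
      (slabRatio T a b u z + m) * spaceDeriv T a b u z / u z ^ 2 -
      h z.1 * (√(1 + spaceDeriv T a b u z ^ 2) *
        (slabRatio T a b u z * spaceDeriv T a b u z / u z)) := by
  obtain ⟨t, s⟩ := z
  obtain ⟨ht, hs⟩ := hz
  have hz : (t, s) ∈ slab T a b := ⟨ht, hs⟩
  have hp := H.pos _ hz
  have hF := hasDerivWithinAt_slab_space (contDiffOn_slabRatio hab H.smooth) ht hs
  have hu := hasDerivWithinAt_slab_space H.smooth ht hs
  have hv := hasDerivWithinAt_sqrt_slope hab H.smooth ht hs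
  have hL := hasDerivWithinAt_slab_space (contDiffOn_dirDeriv hab (1, 0) H.smooth) ht hs
  have hR := (((hF.add_const m).fun_neg.fun_div hu hp.ne').fun_add (hv.const_mul (h t))).congr
    (fun σ hσ => H.equation (t, σ) ⟨ht, hσ⟩) (H.equation (t, s) hz)
  have huniq := uniqueDiffOn_Icc hab s hs
  -- After exchanging the derivatives, the left side is the spatial derivative of `uₜ`, computed
  -- from the equation.
  change dirDeriv _ _ (dirDeriv _ _ u) _ = _
  rw [dirDeriv_comm hab _ _ H.smooth hz, huniq.eq_deriv _ hL hR,
    spaceDeriv_spaceDeriv_eq H.pos hz, ← sq_sqrt_one_add_sq]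
  have hvpos := sqrt_one_add_sq_pos (spaceDeriv T a b u (t, s))
  rw [Real.sqrt_sq hvpos.le]
  field_simp
  ring

/-- A second spatial differentiation of the graph equation. Evaluating at a critical point of `k /
p` removes all terms in its first derivative, which the maximum principle does not need. -/
lemma IsGraphFlow.timeDeriv_spaceDeriv_spaceDeriv (hab : a < b) (H : IsGraphFlow T a b m h u)
    {z : ℝ × ℝ} (hz : z ∈ slab T a b) (hF₁ : spaceDeriv T a b (slabRatio T a b u) z = 0) :
    timeDeriv T a b (spaceDeriv T a b (spaceDeriv T a b u)) z =
      -spaceDeriv T a b (spaceDeriv T a b (slabRatio T a b u)) z / u z -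
      (slabRatio T a b u z + m) * ((1 + spaceDeriv T a b u z ^ 2) * slabRatio T a b u z +
        2 * spaceDeriv T a b u z ^ 2) / u z ^ 3 +
      h z.1 * √(1 + spaceDeriv T a b u z ^ 2) * slabRatio T a b u z *
        ((1 + 2 * spaceDeriv T a b u z ^ 2) * slabRatio T a b u z + spaceDeriv T a b u z ^ 2) /
        u z ^ 2 := by
  obtain ⟨t, s⟩ := z
  obtain ⟨ht, hs⟩ := hz
  have hz : (t, s) ∈ slab T a b := ⟨ht, hs⟩
  have hp := H.pos _ hz
  have hcF := contDiffOn_slabRatio hab H.smooth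
  have hcu := contDiffOn_dirDeriv hab (0, 1) H.smooth
  have hF := hasDerivWithinAt_slab_space hcF ht hs
  have hF' := hasDerivWithinAt_slab_space (contDiffOn_dirDeriv hab (0, 1) hcF) ht hs
  have hu := hasDerivWithinAt_slab_space H.smooth ht hs
  have hu' := hasDerivWithinAt_slab_space hcu ht hs
  have hv := hasDerivWithinAt_sqrt_slope hab H.smooth ht hs
  have hL := hasDerivWithinAt_slab_space (contDiffOn_dirDeriv hab (1, 0) hcu) ht hs
  have hR := (((hF'.fun_neg.fun_div hu hp.ne').fun_add
    (((hF.add_const m).fun_mul hu').fun_div (hu.fun_pow 2) (pow_ne_zero 2 hp.ne'))).fun_sub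
    ((hv.fun_mul ((hF.fun_mul hu').fun_div hu hp.ne')).const_mul (h t))).congr
    (fun σ hσ => H.timeDeriv_spaceDeriv hab (z := (t, σ)) ⟨ht, hσ⟩)
    (H.timeDeriv_spaceDeriv hab hz)
  have huniq := uniqueDiffOn_Icc hab s hs
  change dirDeriv _ _ (dirDeriv _ _ (spaceDeriv T a b u)) _ = _
  rw [dirDeriv_comm hab _ _ hcu hz, huniq.eq_deriv _ hL hR]
  simp only [hF₁, spaceDeriv_spaceDeriv_eq H.pos hz]
  have hvpos := sqrt_one_add_sq_pos (spaceDeriv T a b u (t, s))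
  have hw := sq_sqrt_one_add_sq (spaceDeriv T a b u (t, s))
  generalize √(1 + spaceDeriv T a b u (t, s) ^ 2) = v at *
  rw [← hw]
  have hw' : spaceDeriv T a b u (t, s) ^ 2 = v ^ 2 - 1 := by linarith
  field_simp
  simp only [hw']
  ring

/-- The evolution equation of `k / p` at spatially critical points. -/
lemma IsGraphFlow.timeDeriv_slabRatio (hab : a < b) (H : IsGraphFlow T a b m h u)
    {z : ℝ × ℝ} (hz : z ∈ slab T a b) (hF₁ : spaceDeriv T a b (slabRatio T a b u) z = 0) :
    timeDeriv T a b (slabRatio T a b u) z =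
      spaceDeriv T a b (spaceDeriv T a b (slabRatio T a b u)) z /
        (1 + spaceDeriv T a b u z ^ 2) +
      2 * (slabRatio T a b u z + m) * (1 - slabRatio T a b u z) * spaceDeriv T a b u z ^ 2 /
        ((1 + spaceDeriv T a b u z ^ 2) * u z ^ 2) +
      h z.1 * slabRatio T a b u z * (1 - slabRatio T a b u z) /
        (u z * √(1 + spaceDeriv T a b u z ^ 2)) := by
  obtain ⟨t, s⟩ := z
  obtain ⟨ht, hs⟩ := hz
  have hz : (t, s) ∈ slab T a b := ⟨ht, hs⟩
  have hp := H.pos _ hz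
  have hcu := contDiffOn_dirDeriv hab (0, 1) H.smooth
  have hu := hasDerivAt_slab_time H.smooth ht hs
  have hu' := hasDerivAt_slab_time hcu ht hs
  have hu'' := hasDerivAt_slab_time (contDiffOn_dirDeriv hab (0, 1) hcu) ht hs
  have hL := hasDerivAt_slab_time (contDiffOn_slabRatio hab H.smooth) ht hs
  have hw0 : 1 + spaceDeriv T a b u (t, s) ^ 2 ≠ 0 := by positivity
  have hR := (hu.fun_mul hu'').fun_neg.fun_div ((hu'.fun_pow 2).const_add 1) hw0
  change dirDeriv _ _ _ _ = _
  rw [hL.unique hR]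
  have e0 := H.equation _ hz
  have e1 := H.timeDeriv_spaceDeriv hab hz
  have e2 := H.timeDeriv_spaceDeriv_spaceDeriv hab hz hF₁
  have e3 := spaceDeriv_spaceDeriv_eq H.pos hz
  simp only [timeDeriv, spaceDeriv] at *
  rw [e0, e1, e2, e3, hF₁]
  have hvpos := sqrt_one_add_sq_pos (dirDeriv (slab T a b) (0, 1) u (t, s))
  have hw := sq_sqrt_one_add_sq (dirDeriv (slab T a b) (0, 1) u (t, s))
  generalize √(1 + dirDeriv (slab T a b) (0, 1) u (t, s) ^ 2) = v at *
  rw [← hw]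
  have hw' : dirDeriv (slab T a b) (0, 1) u (t, s) ^ 2 = v ^ 2 - 1 := by linarith
  field_simp
  simp only [hw']
  ring_nf
  simp only [hw']
  ring

/-- `k / p` inherits the Neumann boundary condition. -/
lemma IsGraphFlow.spaceDeriv_slabRatio_eq_zero (hab : a < b) (H : IsGraphFlow T a b m h u)
    (ht : t ∈ Ioo 0 T) (hs : s ∈ Icc a b)
    (h0 : ∀ τ ∈ Ioo 0 T, spaceDeriv T a b u (τ, s) = 0) :
    spaceDeriv T a b (slabRatio T a b u) (t, s) = 0 := by
  have hz : (t, s) ∈ slab T a b := ⟨ht, hs⟩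
  have hp := H.pos _ hz
  have h1 := hasDerivAt_slab_time (contDiffOn_dirDeriv hab (0, 1) H.smooth) ht hs
  have h2 : HasDerivAt (fun τ => spaceDeriv T a b u (τ, s)) 0 t :=
    (hasDerivAt_const t (0 : ℝ)).congr_of_eventuallyEq
      (Filter.eventually_of_mem (isOpen_Ioo.mem_nhds ht) h0)
  have h3 := H.timeDeriv_spaceDeriv hab hz
  -- With `u' = 0`, the differentiated equation reduces to `u'ₜ = -(k / p)' / u`, and `u'ₜ` vanishes
  -- too.
  rw [h0 t ht] at h3
  have h4 := h3.symm.trans (h1.unique h2)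
  simpa [hp.ne'] using h4

end GraphFlow

/-! ### Maximum principle -/

section MaximumPrinciple

variable {T a b : ℝ}

/-- The second derivative test at a maximum over a closed interval, including its endpoints. -/
lemma second_deriv_nonpos_of_isMaxOn (hab : a < b) {g g' : ℝ → ℝ} {c s : ℝ} (hs : s ∈ Icc a b)
    (hmax : IsMaxOn g (Icc a b) s) (hg : ∀ σ ∈ Icc a b, HasDerivWithinAt g (g' σ) (Icc a b) σ)
    (hzero : g' s = 0) (hg' : HasDerivWithinAt g' c (Icc a b) s) : c ≤ 0 := by
  by_contra! hc
  have hlim := hasDerivWithinAt_iff_tendsto_slope.1 hg'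
  have hev := hlim.eventually (eventually_gt_nhds hc)
  obtain ⟨ε, hε, hball⟩ := Metric.mem_nhdsWithin_iff.1 hev
  -- A positive `c` makes `g'` have the sign of `σ - s` near `s`. By the mean value theorem this
  -- contradicts maximality, on the right of `s` if `s < b` and on the left if `s = b`.
  have hslope : ∀ σ ∈ Icc a b, σ ≠ s → |σ - s| < ε → 0 < (σ - s) * g' σ := by
    intro σ hσ hne hd
    have h1 : 0 < slope g' s σ := hball ⟨by simpa [Real.dist_eq] using hd, hσ, hne⟩
    rw [slope_def_field, hzero, sub_zero] at h1
    have h2 : σ - s ≠ 0 := sub_ne_zero.2 hne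
    have h3 : (σ - s) * g' σ = (σ - s) ^ 2 * (g' σ / (σ - s)) := by field_simp
    rw [h3]
    positivity
  have hcont : ContinuousOn g (Icc a b) := fun σ hσ => (hg σ hσ).continuousWithinAt
  have hderiv : ∀ σ ∈ Ioo a b, HasDerivAt g (g' σ) σ := fun σ hσ =>
    (hg σ (Ioo_subset_Icc_self hσ)).hasDerivAt (Icc_mem_nhds hσ.1 hσ.2)
  rcases lt_or_eq_of_le hs.2 with hsb | rfl
  · obtain ⟨r, hr, hr'⟩ := exists_between (lt_min hsb (lt_add_of_pos_right s hε))
    obtain ⟨hrb, hrε⟩ := lt_min_iff.1 hr'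
    obtain ⟨σ, hσ, heq⟩ := exists_hasDerivAt_eq_slope g g' hr
      (hcont.mono (Icc_subset_Icc hs.1 hrb.le))
      fun x hx => hderiv x ⟨hs.1.trans_lt hx.1, hx.2.trans hrb⟩
    have h1 := hslope σ ⟨hs.1.trans hσ.1.le, (hσ.2.trans hrb).le⟩ hσ.1.ne'
      (by rw [abs_of_pos (sub_pos.2 hσ.1)]; linarith [hσ.2])
    have h2 : g r ≤ g s := hmax ⟨hs.1.trans hr.le, hrb.le⟩
    have h3 : g' σ ≤ 0 := heq ▸ div_nonpos_of_nonpos_of_nonneg (by linarith) (by linarith)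
    nlinarith [hσ.1]
  · obtain ⟨r, hr', hr⟩ := exists_between (max_lt hab (sub_lt_self s hε))
    obtain ⟨hra, hrε⟩ := max_lt_iff.1 hr'
    obtain ⟨σ, hσ, heq⟩ := exists_hasDerivAt_eq_slope g g' hr
      (hcont.mono (Icc_subset_Icc hra.le le_rfl))
      fun x hx => hderiv x ⟨hra.trans hx.1, hx.2⟩
    have h1 := hslope σ ⟨(hra.trans hσ.1).le, hσ.2.le⟩ hσ.2.ne
      (by rw [abs_of_neg (sub_neg.2 hσ.2)]; linarith [hσ.1])
    have h2 : g r ≤ g s := hmax ⟨hra.le, hr.le⟩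
    have h3 : 0 ≤ g' σ := heq ▸ div_nonneg (by linarith) (by linarith)
    nlinarith [hσ.2]

/-- A function that exceeds a bound valid at time zero does so at a point at which it is maximal in
space and increasing in time. -/
lemma exists_first_violation {F : ℝ → ℝ → ℝ} {M : ℝ}
    (hF : ContinuousOn (fun z : ℝ × ℝ => F z.1 z.2) (Ico 0 T ×ˢ Icc a b))
    (h0 : ∀ s ∈ Icc a b, F 0 s ≤ M) {t₁ s₁ : ℝ} (ht₁ : t₁ ∈ Ico 0 T) (hs₁ : s₁ ∈ Icc a b)
    (h1 : M < F t₁ s₁) :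
    ∃ t ∈ Ioo 0 T, ∃ s ∈ Icc a b, M < F t s ∧ IsMaxOn (F t) (Icc a b) s ∧
      ∀ d, HasDerivAt (fun τ => F τ s) d t → 0 < d := by
  -- The tilt `F - ε t`, with `ε` so small that it still exceeds `M` at `(t₁, s₁)`, moves its
  -- maximum away from time zero and makes the time derivative of `F` there at least `ε`.
  obtain ⟨ε, hε, hε'⟩ : ∃ ε > 0, ε * t₁ < F t₁ s₁ - M := by
    refine ⟨(F t₁ s₁ - M) / (t₁ + 1), div_pos (by linarith) (by linarith [ht₁.1]), ?_⟩
    rw [div_mul_eq_mul_div, div_lt_iff₀ (by linarith [ht₁.1])]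
    nlinarith
  have hsub : Icc 0 t₁ ×ˢ Icc a b ⊆ Ico 0 T ×ˢ Icc a b :=
    prod_mono (fun τ hτ => ⟨hτ.1, hτ.2.trans_lt ht₁.2⟩) Subset.rfl
  obtain ⟨⟨t, s⟩, ⟨ht, hs⟩, hmax⟩ := (isCompact_Icc.prod isCompact_Icc).exists_isMaxOn
    ⟨(t₁, s₁), ⟨ht₁.1, le_rfl⟩, hs₁⟩
    ((hF.mono hsub).sub (f := fun z : ℝ × ℝ => F z.1 z.2) (g := fun z : ℝ × ℝ => ε * z.1)
      (by fun_prop))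
  have hle : ∀ τ ∈ Icc 0 t₁, ∀ σ ∈ Icc a b, F τ σ - ε * τ ≤ F t s - ε * t :=
    fun τ hτ σ hσ => hmax (show (τ, σ) ∈ Icc 0 t₁ ×ˢ Icc a b from ⟨hτ, hσ⟩)
  simp only at ht hs
  have htop := hle t₁ ⟨ht₁.1, le_rfl⟩ s₁ hs₁
  have htpos : 0 < t := by
    rcases lt_or_eq_of_le ht.1 with h | h
    · exact h
    · rw [← h] at htop
      linarith [h0 s hs]
  have hεt : 0 < ε * t := by positivity
  refine ⟨t, ⟨htpos, ht.2.trans_lt ht₁.2⟩, s, hs, by linarith,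
    fun σ hσ => by simpa using hle t ht σ hσ, fun d hd => hε.trans_le ?_⟩
  -- Maximality is known only for times up to `t₁`, and `t = t₁` is possible; hence left difference
  -- quotients.
  have hlim := (hasDerivAt_iff_tendsto_slope.1 hd).mono_left
    (nhdsWithin_mono t (show Iio t ⊆ {t}ᶜ from fun x hx => ne_of_lt hx))
  refine ge_of_tendsto hlim ?_
  filter_upwards [Ioo_mem_nhdsLT htpos] with τ hτ
  have := hle τ ⟨hτ.1.le, hτ.2.le.trans ht.2⟩ s hs
  rw [slope_def_field, le_div_iff_of_neg (by linarith [hτ.2])]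
  linarith

end MaximumPrinciple

/-! ### From the flow to the graph equation -/

section Flow

variable {n : ℕ} {a b T : ℝ} {ρ₀ : ℝ → ℝ} {ρ : ℝ → ℝ → ℝ}
  {x : Icc a b × Metric.sphere (0 : Cross n) 1 → ℝ → Space n} {t s : ℝ}

lemma exists_norm_eq_one (hn : 1 ≤ n) : ∃ θ : Cross n, ‖θ‖ = 1 :=
  ⟨EuclideanSpace.single ⟨0, hn⟩ 1, by simp⟩

lemma IsFlow.contDiffOn_slice (H : IsFlow n a b ρ₀ T ρ x) (ht : t ∈ Ioo 0 T) :
    ContDiffOn ℝ ∞ (ρ t) (Icc a b) :=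
  H.smooth.comp (contDiffOn_const.prodMk contDiffOn_id) fun _ hσ => ⟨ht, hσ⟩

lemma IsFlow.spaceDeriv_eq (hab : a < b) (H : IsFlow n a b ρ₀ T ρ x) (ht : t ∈ Ioo 0 T)
    (hs : s ∈ Icc a b) : spaceDeriv T a b (fun z => ρ z.1 z.2) (t, s) =
      derivWithin (ρ t) (Icc a b) s :=
  ((hasDerivWithinAt_slab_space H.smooth ht hs).derivWithin (uniqueDiffOn_Icc hab s hs)).symm

lemma IsFlow.spaceDeriv_spaceDeriv_eq (hab : a < b) (H : IsFlow n a b ρ₀ T ρ x)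
    (ht : t ∈ Ioo 0 T) (hs : s ∈ Icc a b) :
    spaceDeriv T a b (spaceDeriv T a b fun z => ρ z.1 z.2) (t, s) =
      derivWithin (derivWithin (ρ t) (Icc a b)) (Icc a b) s := by
  rw [← derivWithin_congr (fun σ hσ => H.spaceDeriv_eq hab ht hσ) (H.spaceDeriv_eq hab ht hs)]
  exact ((hasDerivWithinAt_slab_space (contDiffOn_dirDeriv hab _ H.smooth) ht hs).derivWithin
    (uniqueDiffOn_Icc hab s hs)).symm

lemma IsFlow.slabRatio_eq (hab : a < b) (H : IsFlow n a b ρ₀ T ρ x) (ht : t ∈ Ioo 0 T)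
    (hs : s ∈ Icc a b) :
    slabRatio T a b (fun z => ρ z.1 z.2) (t, s) = curvatureRatio a b (ρ t) s := by
  rw [slabRatio, curvatureRatio, H.spaceDeriv_spaceDeriv_eq hab ht hs, H.spaceDeriv_eq hab ht hs]

/-- The normal velocity of the flow determines the velocity of the graph. -/
lemma IsFlow.timeDeriv_eq (hab : a < b) (H : IsFlow n a b ρ₀ T ρ x)
    (ht : t ∈ Ioo 0 T) (hs : s ∈ Icc a b) {θ : Cross n} (hθ : ‖θ‖ = 1) :
    timeDeriv T a b (fun z => ρ z.1 z.2) (t, s) =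
      -(meanCurvature a b (ρ t) s θ - averageCurvature n a b (ρ t)) *
        √(1 + derivWithin (ρ t) (Icc a b) s ^ 2) := by
  have ht' := Ioo_subset_Ico_self ht
  have hp := H.pos t ht' s hs
  obtain ⟨l, hl⟩ : ∃ l, x l t = position (ρ t) s θ := by
    have := position_mem_surface (n := n) hs hθ hp
    rwa [← H.image t ht'] at this
  have hmem : ∀ τ ∈ Ioo 0 T, x l τ ∈ surface n a b (ρ τ) := fun τ hτ =>
    H.image τ (Ioo_subset_Ico_self hτ) ▸ mem_range_self l
  have hev := H.evolution l t ht
  rw [hl, axial_position, direction_position hθ hp, normal, smul_smul, smul_point] at hev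
  set q := derivWithin (ρ t) (Icc a b) s with hq
  set V := -(meanCurvature a b (ρ t) s θ - averageCurvature n a b (ρ t)) with hV
  have hcoord := hasDerivWithinAt_univ.2 hev
  rw [hasDerivWithinAt_iff_hasFDerivWithinAt, hasFDerivWithinAt_euclidean] at hcoord
  have hax : HasDerivAt (fun τ => axial (x l τ)) (V * (√(1 + q ^ 2))⁻¹ * -q) t := by
    simp only [axial_eq]
    simpa using (hcoord 0).hasDerivWithinAt.hasDerivAt Filter.univ_mem
  have hrad : HasDerivAt (fun τ => radial (x l τ)) ((V * (√(1 + q ^ 2))⁻¹) • θ) t := by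
    rw [← hasDerivWithinAt_univ, hasDerivWithinAt_iff_hasFDerivWithinAt,
      hasFDerivWithinAt_euclidean]
    intro i
    exact (hcoord i.succ).congr_fderiv (by ext; simp)
  have hρ := hasDerivAt_slab_curve H.smooth ht hax fun τ hτ => (hmem τ hτ).1
  -- The point also slides along the axis, so the relation to differentiate is `|x̂|² = ρ(τ, ⟨x,
  -- i₁⟩)²`; squaring avoids differentiating the norm.
  have hsq : (fun τ => ‖radial (x l τ)‖ ^ 2) =ᶠ[nhds t]
      fun τ => ρ τ (axial (x l τ)) ^ 2 :=
    Filter.eventually_of_mem (isOpen_Ioo.mem_nhds ht) fun τ hτ => by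
      change height (x l τ) ^ 2 = _
      rw [(hmem τ hτ).2]
  have hsp : dirDeriv (slab T a b) (0, 1) (fun z => ρ z.1 z.2) (t, s) = q :=
    H.spaceDeriv_eq hab ht hs
  have key := hrad.norm_sq.unique ((hρ.fun_pow 2).congr_of_eventuallyEq hsq)
  simp only [hl, axial_position] at key
  rw [position, radial_point, inner_smul_left, inner_smul_right, real_inner_self_eq_norm_sq, hθ,
    hsp] at key
  simp only [RCLike.conj_to_real] at key
  change dirDeriv _ _ _ _ = _
  generalize dirDeriv (slab T a b) (1, 0) (fun z => ρ z.1 z.2) (t, s) = D at *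
  have hv := sqrt_one_add_sq_pos q
  have hw := sq_sqrt_one_add_sq q
  generalize √(1 + q ^ 2) = v at *
  have h2 : D + q * (V * v⁻¹ * -q) = V * v⁻¹ := by
    have : ρ t s * (D + q * (V * v⁻¹ * -q)) = ρ t s * (V * v⁻¹) := by
      norm_num at key
      linarith
    exact mul_left_cancel₀ hp.ne' this
  have h3 : D = V * v⁻¹ * (1 + q ^ 2) := by linarith
  rw [h3, ← hw]
  field_simp

/-- The radius function of the flow solves the graph equation. -/
lemma IsFlow.isGraphFlow (hn : 1 ≤ n) (hab : a < b) (H : IsFlow n a b ρ₀ T ρ x) :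
    IsGraphFlow T a b (n - 1) (fun t => averageCurvature n a b (ρ t)) fun z => ρ z.1 z.2 where
  smooth := H.smooth
  pos z hz := H.pos z.1 (Ioo_subset_Ico_self hz.1) z.2 hz.2
  neumann_left t ht := by
    rw [H.spaceDeriv_eq hab ht (left_mem_Icc.2 hab.le), H.neumann_left t ht]
  neumann_right t ht := by
    rw [H.spaceDeriv_eq hab ht (right_mem_Icc.2 hab.le), H.neumann_right t ht]
  nonneg t ht := averageCurvature_nonneg hn hab ((H.contDiffOn_slice ht).of_le ENat.LEInfty.out)
    (H.pos t (Ioo_subset_Ico_self ht)) (H.neumann_left t ht) (H.neumann_right t ht)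
  equation := by
    rintro ⟨t, s⟩ ⟨ht, hs⟩
    obtain ⟨θ, hθ⟩ := exists_norm_eq_one hn
    have hp := H.pos t (Ioo_subset_Ico_self ht) s hs
    have hv := sqrt_one_add_sq_pos (derivWithin (ρ t) (Icc a b) s)
    rw [H.timeDeriv_eq hab ht hs hθ, H.slabRatio_eq hab ht hs, H.spaceDeriv_eq hab ht hs,
      meanCurvature_eq_ratio hn hab hs hθ hp ((H.contDiffOn_slice ht).of_le ENat.LEInfty.out)]
    field_simp
    ring

lemma IsFlow.curvatureRatio_initial (H : IsFlow n a b ρ₀ T ρ x)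
    (hs : s ∈ Icc a b) : curvatureRatio a b (ρ 0) s = curvatureRatio a b ρ₀ s := by
  have h1 : EqOn (derivWithin (ρ 0) (Icc a b)) (derivWithin ρ₀ (Icc a b)) (Icc a b) :=
    fun σ hσ => derivWithin_congr H.initial (H.initial σ hσ)
  rw [curvatureRatio, curvatureRatio, h1 hs, H.initial s hs, derivWithin_congr h1 (h1 hs)]

/-- Continuity down to `t = 0` is what lets the initial bound enter the maximum principle; it uses
the `C²` control at time zero. -/
lemma IsFlow.continuousOn_curvatureRatio (H : IsFlow n a b ρ₀ T ρ x) :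
    ContinuousOn (fun z : ℝ × ℝ => curvatureRatio a b (ρ z.1) z.2) (Ico 0 T ×ˢ Icc a b) := by
  have h0 := H.continuous_to_zero 0 (by norm_num)
  have h1 := H.continuous_to_zero 1 (by norm_num)
  have h2 := H.continuous_to_zero 2 le_rfl
  have e1 : ∀ g : ℝ → ℝ, iteratedDerivWithin 1 g (Icc a b) = derivWithin g (Icc a b) :=
    fun g => by ext; simp
  have e2 : ∀ g : ℝ → ℝ, iteratedDerivWithin 2 g (Icc a b) =
      derivWithin (derivWithin g (Icc a b)) (Icc a b) :=
    fun g => by rw [iteratedDerivWithin_succ (n := 1), e1]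
  simp only [iteratedDerivWithin_zero, e1, e2] at h0 h1 h2
  exact (h0.mul h2).neg.div (continuousOn_const.add (h1.pow 2)) fun z _ => by positivity

/-- The maximum principle for `k / p`. -/
lemma IsFlow.curvatureRatio_le (hn : 1 ≤ n) (hab : a < b) (H : IsFlow n a b ρ₀ T ρ x) {M : ℝ}
    (hM : 1 ≤ M) (h0 : ∀ s ∈ Icc a b, curvatureRatio a b ρ₀ s ≤ M) (ht : t ∈ Ico 0 T)
    (hs : s ∈ Icc a b) : curvatureRatio a b (ρ t) s ≤ M := by
  by_contra! hlt
  obtain ⟨τ, hτ, σ, hσ, hgt, hmax, hinc⟩ := exists_first_violation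
    (F := fun τ σ => curvatureRatio a b (ρ τ) σ) H.continuousOn_curvatureRatio
    (fun r hr => (H.curvatureRatio_initial hr).trans_le (h0 r hr)) ht hs hlt
  have G := H.isGraphFlow hn hab
  have hz : (τ, σ) ∈ slab T a b := ⟨hτ, hσ⟩
  have hcF := contDiffOn_slabRatio hab H.smooth
  have htime : 0 < timeDeriv T a b (slabRatio T a b fun z => ρ z.1 z.2) (τ, σ) := by
    refine hinc _ ((hasDerivAt_slab_time hcF hτ hσ).congr_of_eventuallyEq ?_)
    exact Filter.eventually_of_mem (isOpen_Ioo.mem_nhds hτ)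
      fun r hr => (H.slabRatio_eq hab hr hσ).symm
  have hmax' : IsMaxOn (fun r => slabRatio T a b (fun z => ρ z.1 z.2) (τ, r)) (Icc a b) σ := by
    intro r hr
    change slabRatio _ _ _ _ _ ≤ slabRatio _ _ _ _ _
    rw [H.slabRatio_eq hab hτ hr, H.slabRatio_eq hab hτ hσ]
    exact hmax hr
  have hspace := fun r hr => hasDerivWithinAt_slab_space (t := τ) (s := r) hcF hτ hr
  have hzero : spaceDeriv T a b (slabRatio T a b fun z => ρ z.1 z.2) (τ, σ) = 0 := by
    -- Interior maxima are critical by Fermat's theorem; at the endpoints the inherited Neumann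
    -- condition takes its place.
    rcases eq_or_ne σ a with rfl | hσa
    · exact G.spaceDeriv_slabRatio_eq_zero hab hτ hσ G.neumann_left
    rcases eq_or_ne σ b with rfl | hσb
    · exact G.spaceDeriv_slabRatio_eq_zero hab hτ hσ G.neumann_right
    have hnhds := Icc_mem_nhds (lt_of_le_of_ne hσ.1 hσa.symm) (lt_of_le_of_ne hσ.2 hσb)
    exact (hmax'.isLocalMax hnhds).hasDerivAt_eq_zero ((hspace σ hσ).hasDerivAt hnhds)
  have hsecond := second_deriv_nonpos_of_isMaxOn hab hσ hmax' hspace hzero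
    (hasDerivWithinAt_slab_space (contDiffOn_dirDeriv hab _ hcF) hτ hσ)
  have hevol := G.timeDeriv_slabRatio hab hz hzero
  have hp := G.pos _ hz
  have hF : 1 < slabRatio T a b (fun z => ρ z.1 z.2) (τ, σ) := by
    rw [H.slabRatio_eq hab hτ hσ]
    linarith
  have hh := G.nonneg τ hτ
  have hm : (0 : ℝ) ≤ n - 1 := sub_nonneg.2 (mod_cast hn)
  have hfirst := div_nonpos_of_nonpos_of_nonneg hsecond
    (show 0 ≤ 1 + spaceDeriv T a b (fun z => ρ z.1 z.2) (τ, σ) ^ 2 by positivity)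
  have hgrad : 2 * (slabRatio T a b (fun z => ρ z.1 z.2) (τ, σ) + (n - 1)) *
      (1 - slabRatio T a b (fun z => ρ z.1 z.2) (τ, σ)) *
      spaceDeriv T a b (fun z => ρ z.1 z.2) (τ, σ) ^ 2 /
      ((1 + spaceDeriv T a b (fun z => ρ z.1 z.2) (τ, σ) ^ 2) * ρ τ σ ^ 2) ≤ 0 :=
    div_nonpos_of_nonpos_of_nonneg (mul_nonpos_of_nonpos_of_nonneg
      (mul_nonpos_of_nonneg_of_nonpos (by linarith) (by linarith)) (sq_nonneg _)) (by positivity)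
  have hforce : averageCurvature n a b (ρ τ) * slabRatio T a b (fun z => ρ z.1 z.2) (τ, σ) *
      (1 - slabRatio T a b (fun z => ρ z.1 z.2) (τ, σ)) /
      (ρ τ σ * √(1 + spaceDeriv T a b (fun z => ρ z.1 z.2) (τ, σ) ^ 2)) ≤ 0 :=
    div_nonpos_of_nonpos_of_nonneg
      (mul_nonpos_of_nonneg_of_nonpos (mul_nonneg hh (by linarith)) (by linarith)) (by positivity)
  -- All three terms of the evolution equation are nonpositive, against `htime`.
  simp only at hevol
  linarith

end Flow

end AxialFlow

/-! ### The constant determined by the initial hypersurface -/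

theorem proposition5p3 (n : ℕ) (hn : 2 ≤ n) (a b : ℝ) (hab : a < b) (ρ₀ : ℝ → ℝ)
    (hρ₀ : AxialFlow.IsInitialRadius a b ρ₀) :
    ∃ c₁ : ℝ, ∀ (T : ℝ) (ρ : ℝ → ℝ → ℝ)
      (x : Set.Icc a b × Metric.sphere (0 : AxialFlow.Cross n) 1 → ℝ → AxialFlow.Space n),
      0 < T → AxialFlow.IsFlow n a b ρ₀ T ρ x →
      ∀ t ∈ Set.Ico 0 T, ∀ z ∈ AxialFlow.surface n a b (ρ t),
        AxialFlow.curvK a b (ρ t) (AxialFlow.axial z) (AxialFlow.direction z) /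
          AxialFlow.curvP a b (ρ t) (AxialFlow.axial z) (AxialFlow.direction z) < c₁ := by
  have hn1 : 1 ≤ n := by omega
  have hC2 : ContDiffOn ℝ 2 ρ₀ (Icc a b) := hρ₀.smooth.of_le ENat.LEInfty.out
  obtain ⟨C, hC⟩ : BddAbove (AxialFlow.curvatureRatio a b ρ₀ '' Icc a b) := by
    have h1 := hC2.derivWithin (m := 1) (uniqueDiffOn_Icc hab) (by norm_num)
    have h2 := h1.continuousOn_derivWithin (uniqueDiffOn_Icc hab) (by simp)
    exact isCompact_Icc.bddAbove_image ((hC2.continuousOn.mul h2).neg.div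
      (continuousOn_const.add (h1.continuousOn.pow 2)) fun s _ => by positivity)
  -- The `1` in the maximum is the threshold beyond which the reaction terms have a sign; the added
  -- `1` makes the inequality strict.
  refine ⟨max 1 C + 1, fun T ρ x _ H t ht z hz => ?_⟩
  have hs := hz.1
  have hp := H.pos t ht _ hs
  have hθ : ‖AxialFlow.direction z‖ = 1 := by
    have hh : 0 < ‖AxialFlow.radial z‖ := by
      change 0 < AxialFlow.height z
      rwa [hz.2]
    rw [AxialFlow.direction, norm_smul, AxialFlow.height, norm_inv, norm_norm,
      inv_mul_cancel₀ hh.ne']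
  -- Smoothness of the flow is given only for `t > 0`; at `t = 0` it comes from `ρ₀`.
  have hρ : ContDiffOn ℝ 2 (ρ t) (Icc a b) := by
    rcases eq_or_lt_of_le ht.1 with rfl | h
    · exact hC2.congr H.initial
    · exact (H.contDiffOn_slice ⟨h, ht.2⟩).of_le ENat.LEInfty.out
  rw [AxialFlow.curvK_div_curvP hab hs hθ hp hρ]
  have := H.curvatureRatio_le hn1 hab (le_max_left 1 C)
    (fun s hs => (hC (mem_image_of_mem _ hs)).trans (le_max_right _ _)) ht hs
  linarith
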